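/- For $\lambda>-\tfrac12$ let $w_\lambda(t)=(1-t^2)^{\lambda-1/2}$ on $(-1,1)$ and $\|f\|_{w_\lambda}=\bigl(\int_{-1}^{1}w_\lambda(t)f(t)^2\,dt\bigr)^{1/2}$. For $n\in\mathbb N$ let $\mathcal P_n$ be the set of real polynomials of degree at most $n$, and let $$c_n(\lambda)=\sup_{p\in\mathcal P_n,\;p\neq0}\frac{\|p'\|_{w_\lambda}}{\|p\|_{w_\lambda}}.$$ Then for all $n\ge 3$ and every $\lambda>-\tfrac12$, the number $c_n(\lambda)$ is finite and is the best (smallest) constant in the Markov inequality $\|p'\|_{w_\lambda}\le c_n(\lambda)\,\|p\|_{w_\lambda}$, $p\in\mathcal P_n$, and it satisfies $$\frac{(n+1)\bigl(n+\lambda+\frac12\bigr)^2(n+2\lambda)}{(2\lambda+1)(2\lambda+5)}\;\le\;c_n(\lambda)^2\;\le\;\frac{\bigl(n+\frac54\lambda+\frac98\bigr)^4}{2(2\lambda+1)\sqrt{2\lambda+5}}.$$ -/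

import Mathlib

/-- The Gegenbauer weight `(1 - t ^ 2) ^ (lam - 1 / 2)`, considered on `(-1, 1)`. -/
noncomputable def gegenbauerWeight (lam t : ℝ) : ℝ := (1 - t ^ 2) ^ (lam - 1 / 2)

/-- The weighted `L₂`-norm on `(-1, 1)` of a real polynomial. -/
noncomputable def gegenbauerNorm (lam : ℝ) (p : Polynomial ℝ) : ℝ :=
  Real.sqrt (∫ t in (-1 : ℝ)..1, gegenbauerWeight lam t * (p.eval t) ^ 2)

/-- The best Markov constant: the supremum of `‖p'‖ / ‖p‖` over all nonzero real polynomials `p`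
of degree at most `n`. -/
noncomputable def markovConstant (n : ℕ) (lam : ℝ) : ℝ :=
  sSup {r : ℝ | ∃ p : Polynomial ℝ, p ≠ 0 ∧ p.natDegree ≤ n ∧
    r = gegenbauerNorm lam (Polynomial.derivative p) / gegenbauerNorm lam p}

/-! Write `L` for integration against the weight, `U k` for the Gegenbauer polynomials and h_k =
L(U_k²). In the orthogonal basis `U k`, c_n² is the largest eigenvalue of the Gram matrix A_kl =
L(U_k' U_l') / √(h_k h_l), k, l ≤ n. Entries of opposite parity vanish, so A splits into two blocks.
Within a block L(U_k' U_l') depends only on the smaller index, because U_{l+2}' - U_l' is a multiple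
of U_{l+1}, which is orthogonal to all lower degrees.

A positive semidefinite matrix satisfies tr(A²) / tr A ≤ λ_max ≤ √tr(A²). The left inequality
(`trace_sq_le`), for the block of the parity of n, gives the lower bound; the right one
(`derivative_norm_sq_le`), for both blocks, gives the upper bound. The trace has a closed form
(`sum_derivativeEnergy`), and so has the increment of tr(A²) from n to n + 2 (`gramSq_add_two`).
Both estimates then follow by two-step induction from polynomial inequalities in n and s = 2λ + 1
whose expanded differences have nonnegative coefficients.

The Gram matrix computations use only that `L` obeys integration by parts and that L 1 > 0. -/

/-! ### Differential identities for Gegenbauer polynomials -/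

section Algebra

open Polynomial

/-- The coefficient of `U k` in `U (k + 1)' - X * U k'`. -/
noncomputable def gegenbauerShift (lam : ℝ) (k : ℕ) : ℝ := if k = 0 then 1 else k + 2 * lam

/-- The Gegenbauer polynomials `C_k / (2 * lam)` for `k ≥ 1`, with `1` for `k = 0`. This
normalization is also meaningful for `lam = 0`. -/
noncomputable def gegenbauerPoly (lam : ℝ) : ℕ → ℝ[X]
  | 0 => 1
  | 1 => X
  | k + 2 => C (1 / ((k : ℝ) + 2)) *
      (C (2 * ((k : ℝ) + 1 + lam)) * X * gegenbauerPoly lam (k + 1) -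
        C (gegenbauerShift lam k) * gegenbauerPoly lam k)

theorem gegenbauerPoly_recurrence (lam : ℝ) (k : ℕ) :
    C ((k : ℝ) + 2) * gegenbauerPoly lam (k + 2) =
      C (2 * ((k : ℝ) + 1 + lam)) * (X * gegenbauerPoly lam (k + 1)) -
        C (gegenbauerShift lam k) * gegenbauerPoly lam k := by
  have hk : (k : ℝ) + 2 ≠ 0 := by positivity
  rw [gegenbauerPoly, ← mul_assoc, ← C_mul, mul_one_div_cancel hk, C_1]
  ring

/-- The two identities feed each other, hence the joint induction: the differentiated recurrence and
the first identity give the next second one, which with both old identities gives the next first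
one. -/
theorem gegenbauerPoly_derivative_aux (lam : ℝ) (k : ℕ) :
    X * derivative (gegenbauerPoly lam (k + 1)) - derivative (gegenbauerPoly lam k) =
        C ((k : ℝ) + 1) * gegenbauerPoly lam (k + 1) ∧
      derivative (gegenbauerPoly lam (k + 1)) =
        X * derivative (gegenbauerPoly lam k) +
          C (gegenbauerShift lam k) * gegenbauerPoly lam k := by
  induction k with
  | zero => simp [gegenbauerPoly, gegenbauerShift]
  | succ k ih =>
    obtain ⟨ha, hb⟩ := ih
    have hC : (C (2 : ℝ) : ℝ[X]) = 2 := rfl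
    have hC1 : (C (1 : ℝ) : ℝ[X]) = 1 := rfl
    have hrec := gegenbauerPoly_recurrence lam k
    have hd := congrArg derivative hrec
    simp only [derivative_sub, derivative_mul, derivative_C, derivative_X, zero_mul, zero_add,
      one_mul] at hd
    have hk : (C ((k : ℝ) + 2) : ℝ[X]) ≠ 0 := by
      rw [Ne, C_eq_zero]; positivity
    have he : gegenbauerShift lam (k + 1) = k + 1 + 2 * lam := by simp [gegenbauerShift]
    have hb' : derivative (gegenbauerPoly lam (k + 2)) =
        X * derivative (gegenbauerPoly lam (k + 1)) +
          C (gegenbauerShift lam (k + 1)) * gegenbauerPoly lam (k + 1) := by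
      apply mul_left_cancel₀ hk
      rw [he]
      -- The normalization of `U 0` makes the shift at 0 equal to 1 instead of 2λ.
      rcases Nat.eq_zero_or_pos k with rfl | hpos
      · rw [hd]
        simp only [gegenbauerPoly, gegenbauerShift, derivative_X, derivative_one, C_add, C_mul, hC,
          hC1, if_true, Nat.cast_zero, C_0]
        ring
      · have hek : gegenbauerShift lam k = k + 2 * lam := by simp [gegenbauerShift, hpos.ne']
        rw [hek] at hd
        simp only [C_add, C_mul, hC, hC1] at hd ha ⊢
        linear_combination hd + (C (k : ℝ) + 2 * C lam) * ha
    refine ⟨?_, hb'⟩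
    push_cast
    simp only [show k + 1 + 1 = k + 2 from rfl] at *
    rw [hb', he]
    have h2 : (k : ℝ) + 1 + 1 = k + 2 := by ring
    rw [h2, hrec]
    simp only [C_add, C_mul] at ha hb ⊢
    simp only [hC, hC1] at *
    linear_combination X * ha - hb

theorem gegenbauerPoly_X_mul_derivative (lam : ℝ) (k : ℕ) :
    X * derivative (gegenbauerPoly lam (k + 1)) = derivative (gegenbauerPoly lam k) +
        C ((k : ℝ) + 1) * gegenbauerPoly lam (k + 1) := by
  linear_combination (gegenbauerPoly_derivative_aux lam k).1

theorem gegenbauerPoly_derivative_succ (lam : ℝ) (k : ℕ) :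
    derivative (gegenbauerPoly lam (k + 1)) = X * derivative (gegenbauerPoly lam k) +
        C (gegenbauerShift lam k) * gegenbauerPoly lam k :=
  (gegenbauerPoly_derivative_aux lam k).2

theorem gegenbauerPoly_derivative_add_two (lam : ℝ) (k : ℕ) :
    derivative (gegenbauerPoly lam (k + 2)) = derivative (gegenbauerPoly lam k) +
        C (2 * ((k : ℝ) + 1 + lam)) * gegenbauerPoly lam (k + 1) := by
  have h1 := gegenbauerPoly_derivative_succ lam (k + 1)
  have h2 := gegenbauerPoly_X_mul_derivative lam k
  have he : gegenbauerShift lam (k + 1) = k + 1 + 2 * lam := by simp [gegenbauerShift]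
  rw [he] at h1
  rw [show k + 2 = k + 1 + 1 from rfl, h1, h2]
  have h3 : C (2 * ((k : ℝ) + 1 + lam)) = C ((k : ℝ) + 1) + C (k + 1 + 2 * lam) := by
    rw [← C_add]; congr 1; ring
  rw [h3]
  ring

theorem gegenbauerPoly_structure (lam : ℝ) (k : ℕ) :
    (1 - X ^ 2) * derivative (gegenbauerPoly lam (k + 1)) =
      C (gegenbauerShift lam k) * gegenbauerPoly lam k -
        C ((k : ℝ) + 1) * (X * gegenbauerPoly lam (k + 1)) := by
  linear_combination gegenbauerPoly_derivative_succ lam k -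
    X * gegenbauerPoly_X_mul_derivative lam k

theorem gegenbauerPoly_ode (lam : ℝ) (k : ℕ) :
    (1 - X ^ 2) * derivative (derivative (gegenbauerPoly lam k)) -
        C (2 * lam + 1) * (X * derivative (gegenbauerPoly lam k)) =
      - (C ((k : ℝ) * (k + 2 * lam)) * gegenbauerPoly lam k) := by
  rcases k with _ | k
  · simp [gegenbauerPoly]
  have hd := congrArg derivative (gegenbauerPoly_structure lam k)
  have hX := gegenbauerPoly_X_mul_derivative lam k
  simp only [derivative_sub, derivative_mul, derivative_C, derivative_X, zero_mul, zero_add,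
    one_mul, derivative_one, derivative_X_pow] at hd
  rcases Nat.eq_zero_or_pos k with rfl | hpos
  · simp [gegenbauerPoly]
    ring
  · have hek : gegenbauerShift lam k = k + 2 * lam := by simp [gegenbauerShift, hpos.ne']
    rw [hek] at hd
    have hC : (C (2 : ℝ) : ℝ[X]) = 2 := rfl
    have hC1 : (C (1 : ℝ) : ℝ[X]) = 1 := rfl
    push_cast at hd ⊢
    simp only [C_add, C_mul, hC, hC1, pow_one] at hd hX ⊢
    linear_combination hd - (C (k : ℝ) + 2 * C lam) * hX

end Algebra

/-! ### Orthogonality, norms and Gram entries from integration by parts -/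

section Functional

open Polynomial

/-- The integration by parts rule satisfied by integration against the Gegenbauer weight. -/
def IsGegenbauerFunctional (lam : ℝ) (L : ℝ[X] →ₗ[ℝ] ℝ) : Prop :=
  ∀ q : ℝ[X], L ((1 - X ^ 2) * derivative q - C (2 * lam + 1) * (X * q)) = 0

theorem map_C_mul (L : ℝ[X] →ₗ[ℝ] ℝ) (a : ℝ) (p : ℝ[X]) : L (C a * p) = a * L p := by
  rw [← smul_eq_C_mul, map_smul, smul_eq_mul]

variable {lam : ℝ} {L : ℝ[X] →ₗ[ℝ] ℝ}

local notation "U" => gegenbauerPoly lam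

/-- Sturm–Liouville symmetry: the left side is symmetric in j and k while the right side carries the
eigenvalue of k, so distinct eigenvalues force orthogonality. -/
theorem IsGegenbauerFunctional.map_derivative_mul_derivative (hL : IsGegenbauerFunctional lam L)
    (j k : ℕ) :
    L ((1 - X ^ 2) * (derivative (U j) * derivative (U k))) =
      (k : ℝ) * (k + 2 * lam) * L (U j * U k) := by
  have h := hL (U j * derivative (U k))
  have hode := gegenbauerPoly_ode lam k
  rw [derivative_mul] at h
  have e : (1 - X ^ 2) * (derivative (U j) * derivative (U k) +
        U j * derivative (derivative (U k))) - C (2 * lam + 1) * (X * (U j * derivative (U k))) =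
      (1 - X ^ 2) * (derivative (U j) * derivative (U k)) -
        C ((k : ℝ) * (k + 2 * lam)) * (U j * U k) := by
    linear_combination U j * hode
  rw [e, map_sub, map_C_mul] at h
  linarith

theorem IsGegenbauerFunctional.map_mul_of_lt (hlam : -(1 / 2 : ℝ) < lam)
    (hL : IsGegenbauerFunctional lam L) {j k : ℕ} (hjk : j < k) : L (U j * U k) = 0 := by
  have h1 := hL.map_derivative_mul_derivative j k
  have h2 := hL.map_derivative_mul_derivative k j
  rw [mul_comm (derivative (U k)), mul_comm (U k)] at h2
  have h3 : ((k : ℝ) - j) * (k + j + 2 * lam) * L (U j * U k) = 0 := by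
    linear_combination h2 - h1
  have hj : (0 : ℝ) ≤ j := Nat.cast_nonneg j
  have hk : (j : ℝ) + 1 ≤ k := by exact_mod_cast hjk
  have h4 : ((k : ℝ) - j) * (k + j + 2 * lam) ≠ 0 :=
    mul_ne_zero (by linarith) (by linarith)
  exact (mul_eq_zero.mp h3).resolve_left h4

theorem IsGegenbauerFunctional.map_mul_of_ne (hlam : -(1 / 2 : ℝ) < lam)
    (hL : IsGegenbauerFunctional lam L) {j k : ℕ} (hjk : j ≠ k) : L (U j * U k) = 0 := by
  rcases lt_or_gt_of_ne hjk with h | h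
  · exact hL.map_mul_of_lt hlam h
  · rw [mul_comm]; exact hL.map_mul_of_lt hlam h

theorem IsGegenbauerFunctional.norm_sq_one (hL : IsGegenbauerFunctional lam L) :
    (2 + 2 * lam) * L (U 1 * U 1) = L (U 0 * U 0) := by
  have h := hL X
  have e : (1 - X ^ 2) * derivative X - C (2 * lam + 1) * (X * X) =
      (1 * 1 : ℝ[X]) - C (2 * lam + 2) * (X * X) := by
    rw [derivative_X, show (2 * lam + 2 : ℝ) = (2 * lam + 1) + 1 by ring,
      C_add (a := 2 * lam + 1), C_1]
    ring
  rw [e, map_sub, map_C_mul] at h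
  simp only [gegenbauerPoly]
  linarith

/-- Pairing the recurrence for U_{k+2} with U_{k+2}, and the one for U_{k+3} with U_{k+1}, expresses
both norms through L(X U_{k+1} U_{k+2}), which is then eliminated. -/
theorem IsGegenbauerFunctional.norm_sq_add_two (hlam : -(1 / 2 : ℝ) < lam)
    (hL : IsGegenbauerFunctional lam L) (k : ℕ) :
    ((k : ℝ) + 2) * (k + 2 + lam) * L (U (k + 2) * U (k + 2)) =
      (k + 1 + lam) * (k + 1 + 2 * lam) * L (U (k + 1) * U (k + 1)) := by
  have r1 := congrArg (fun p => L (p * U (k + 2))) (gegenbauerPoly_recurrence lam k)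
  have r2 := congrArg (fun p => L (p * U (k + 1))) (gegenbauerPoly_recurrence lam (k + 1))
  have he : gegenbauerShift lam (k + 1) = k + 1 + 2 * lam := by simp [gegenbauerShift]
  simp only [sub_mul, mul_assoc, map_sub, map_C_mul, he] at r1 r2
  rw [hL.map_mul_of_ne hlam (show k ≠ k + 2 by omega)] at r1
  rw [hL.map_mul_of_ne hlam (show k + 1 + 2 ≠ k + 1 by omega)] at r2
  have e : L (X * (U (k + 1 + 1) * U (k + 1))) = L (X * (U (k + 1) * U (k + 2))) := by
    rw [mul_comm (U (k + 1))]
  rw [e] at r2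
  push_cast at r2
  linear_combination (k + 2 + lam) * r1 - (k + 1 + lam) * r2

theorem IsGegenbauerFunctional.norm_sq_pos (hlam : -(1 / 2 : ℝ) < lam)
    (hL : IsGegenbauerFunctional lam L) (h1 : 0 < L 1) (k : ℕ) : 0 < L (U k * U k) := by
  have h0 : 0 < L (U 0 * U 0) := by simpa [gegenbauerPoly] using h1
  rcases k with _ | k
  · exact h0
  induction k with
  | zero =>
    have h := hL.norm_sq_one
    exact (mul_pos_iff_of_pos_left (by linarith)).mp (h ▸ h0)
  | succ k ih =>
    have hk : (0 : ℝ) ≤ k := Nat.cast_nonneg k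
    have h := hL.norm_sq_add_two hlam k
    have hmul := mul_pos (mul_pos (show 0 < (k : ℝ) + 1 + lam by linarith)
      (show 0 < (k : ℝ) + 1 + 2 * lam by linarith)) ih
    rw [← h] at hmul
    exact (mul_pos_iff_of_pos_left (mul_pos (by linarith) (by linarith))).mp hmul

/-- U_k' is a combination of U_{k-1}, U_{k-3}, …, among which U_m does not occur. -/
theorem IsGegenbauerFunctional.map_derivative_mul (hlam : -(1 / 2 : ℝ) < lam)
    (hL : IsGegenbauerFunctional lam L) (k m : ℕ) (hkm : k ≤ m ∨ k % 2 = m % 2) :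
    L (derivative (U k) * U m) = 0 := by
  induction k using Nat.twoStepInduction with
  | zero => simp [gegenbauerPoly]
  | one =>
    have h := hL.map_mul_of_ne hlam (show 0 ≠ m by omega)
    simpa [gegenbauerPoly] using h
  | more k ih _ =>
    rw [gegenbauerPoly_derivative_add_two, add_mul, mul_assoc, map_add, map_C_mul,
      ih (by omega), hL.map_mul_of_ne hlam (by omega)]
    simp

theorem IsGegenbauerFunctional.map_derivative_mul_derivative_of_parity_ne
    (hlam : -(1 / 2 : ℝ) < lam) (hL : IsGegenbauerFunctional lam L) (k l : ℕ)
    (hkl : k % 2 ≠ l % 2) : L (derivative (U k) * derivative (U l)) = 0 := by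
  induction l using Nat.twoStepInduction with
  | zero => simp [gegenbauerPoly]
  | one =>
    have h := hL.map_derivative_mul hlam k 0 (by omega)
    simpa [gegenbauerPoly] using h
  | more l ih _ =>
    rw [gegenbauerPoly_derivative_add_two, mul_add, mul_left_comm, map_add, map_C_mul,
      ih (by omega), hL.map_derivative_mul hlam _ _ (by omega)]
    simp

/-- Raising the larger index adds to its derivative only multiples of some U_m with m > k,
orthogonal to U_k'. -/
theorem IsGegenbauerFunctional.map_derivative_mul_derivative_of_le
    (hlam : -(1 / 2 : ℝ) < lam) (hL : IsGegenbauerFunctional lam L) (k i : ℕ) :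
    L (derivative (U k) * derivative (U (k + 2 * i))) =
      L (derivative (U k) * derivative (U k)) := by
  induction i with
  | zero => rfl
  | succ i ih =>
    rw [show k + 2 * (i + 1) = k + 2 * i + 2 by ring, gegenbauerPoly_derivative_add_two, mul_add,
      mul_left_comm, map_add, map_C_mul, ih, hL.map_derivative_mul hlam _ _ (by omega)]
    simp

/-- The squared norm of the derivative of the normalized Gegenbauer polynomial, up to the factor
`2 * lam + 1`. -/
def derivativeEnergy (lam x : ℝ) : ℝ := 2 * x * (x + lam) * (x + 2 * lam)

/-- Pythagoras: the two summands of U_{k+2}' = U_k' + 2(k+1+λ) U_{k+1} are orthogonal; the norm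
ratios then close the induction. -/
theorem IsGegenbauerFunctional.derivative_norm_sq (hlam : -(1 / 2 : ℝ) < lam)
    (hL : IsGegenbauerFunctional lam L) (k : ℕ) :
    (2 * lam + 1) * L (derivative (U k) * derivative (U k)) =
      derivativeEnergy lam k * L (U k * U k) := by
  have step : ∀ k : ℕ, L (derivative (U (k + 2)) * derivative (U (k + 2))) =
      L (derivative (U k) * derivative (U k)) +
        (2 * ((k : ℝ) + 1 + lam)) ^ 2 * L (U (k + 1) * U (k + 1)) := by
    intro k
    have e : derivative (U (k + 2)) * derivative (U (k + 2)) =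
        derivative (U k) * derivative (U k) + C (2 * (2 * ((k : ℝ) + 1 + lam))) *
          (derivative (U k) * U (k + 1)) +
        C ((2 * ((k : ℝ) + 1 + lam)) ^ 2) * (U (k + 1) * U (k + 1)) := by
      rw [gegenbauerPoly_derivative_add_two, C_mul (a := 2) (b := 2 * ((k : ℝ) + 1 + lam)), C_pow,
        show (C (2 : ℝ) : ℝ[X]) = 2 from rfl]
      ring
    rw [e, map_add, map_add, map_C_mul, map_C_mul, hL.map_derivative_mul hlam _ _ (by omega)]
    ring
  unfold derivativeEnergy
  induction k using Nat.twoStepInduction with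
  | zero => simp [gegenbauerPoly]
  | one =>
    have h := hL.norm_sq_one
    have h' : L (derivative (U 1) * derivative (U 1)) = L (U 0 * U 0) := by simp [gegenbauerPoly]
    rw [h', ← h]
    push_cast
    ring
  | more k ih _ =>
    have h2 := hL.norm_sq_add_two hlam k
    rw [step]
    push_cast
    -- The ratio of h_0 to h_1 does not follow the general pattern, but U_0' = 0 makes it
    -- unnecessary.
    rcases k with _ | k
    · simp only [gegenbauerPoly, derivative_one, mul_zero, map_zero] at *
      push_cast at *
      linear_combination (-2 * (2 + 2 * lam)) * h2
    · have h3 := hL.norm_sq_add_two hlam (k + 1)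
      have h4 := hL.norm_sq_add_two hlam k
      push_cast at *
      have e : (2 * lam + 1) * L (derivative (U (k + 1)) * derivative (U (k + 1))) =
          2 * (k + 1) * (k + 2) * (k + 2 + lam) * L (U (k + 2) * U (k + 2)) := by
        linear_combination ih - 2 * (k + 1) * h4
      linear_combination e - 2 * (k + 3 + 2 * lam) * h3

end Functional

/-! ### Gegenbauer expansions and the two trace inequalities -/

section Expansion

open Polynomial

theorem gegenbauerPoly_natDegree_le (lam : ℝ) (k : ℕ) : (gegenbauerPoly lam k).natDegree ≤ k := by
  induction k using Nat.twoStepInduction with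
  | zero => simp [gegenbauerPoly]
  | one => simp [gegenbauerPoly]
  | more k ih1 ih2 =>
    rw [gegenbauerPoly]
    refine (natDegree_C_mul_le _ _).trans ((natDegree_sub_le _ _).trans (max_le ?_ ?_))
    · rw [mul_assoc]
      refine (natDegree_C_mul_le _ _).trans (natDegree_mul_le.trans ?_)
      rw [natDegree_X]
      omega
    · exact (natDegree_C_mul_le _ _).trans (by omega)

theorem gegenbauerPoly_coeff_self_pos {lam : ℝ} (hlam : -(1 / 2 : ℝ) < lam) (k : ℕ) :
    0 < (gegenbauerPoly lam k).coeff k := by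
  rcases k with _ | k
  · simp [gegenbauerPoly]
  induction k with
  | zero => simp [gegenbauerPoly]
  | succ k ih =>
    have hk : (0 : ℝ) ≤ k := Nat.cast_nonneg k
    have h0 : (gegenbauerPoly lam k).coeff (k + 2) = 0 :=
      coeff_eq_zero_of_natDegree_lt ((gegenbauerPoly_natDegree_le lam k).trans_lt (by omega))
    rw [show k + 1 + 1 = k + 2 from rfl, gegenbauerPoly, coeff_C_mul, coeff_sub, mul_assoc,
      coeff_C_mul, coeff_X_mul, coeff_C_mul, h0, mul_zero, sub_zero]
    exact mul_pos (by positivity) (mul_pos (by linarith) ih)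

theorem exists_gegenbauerPoly_expansion {lam : ℝ} (hlam : -(1 / 2 : ℝ) < lam) (n : ℕ) (p : ℝ[X])
    (hp : p.natDegree ≤ n) :
    ∃ x : ℕ → ℝ, p = ∑ k ∈ Finset.range (n + 1), C (x k) * gegenbauerPoly lam k := by
  induction n generalizing p with
  | zero =>
    refine ⟨fun _ => p.coeff 0, ?_⟩
    simpa [gegenbauerPoly] using eq_C_of_natDegree_le_zero hp
  | succ n ih =>
    set a := p.coeff (n + 1) / (gegenbauerPoly lam (n + 1)).coeff (n + 1) with ha
    have hdeg : (p - C a * gegenbauerPoly lam (n + 1)).natDegree ≤ n + 1 :=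
      (natDegree_sub_le _ _).trans (max_le hp
        ((natDegree_C_mul_le _ _).trans (gegenbauerPoly_natDegree_le lam _)))
    have hcoeff : (p - C a * gegenbauerPoly lam (n + 1)).coeff (n + 1) = 0 := by
      rw [coeff_sub, coeff_C_mul, ha,
        div_mul_cancel₀ _ (gegenbauerPoly_coeff_self_pos hlam (n + 1)).ne', sub_self]
    obtain ⟨x, hx⟩ := ih _ (natDegree_le_pred hdeg hcoeff)
    refine ⟨Function.update x (n + 1) a, ?_⟩
    rw [Finset.sum_range_succ, Function.update_self, ← sub_eq_iff_eq_add, hx]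
    refine Finset.sum_congr rfl fun k hk => ?_
    rw [Function.update_of_ne (by rw [Finset.mem_range] at hk; omega)]

variable {lam : ℝ} {L : ℝ[X] →ₗ[ℝ] ℝ}

local notation "U" => gegenbauerPoly lam

theorem map_sum_C_mul_mul (L : ℝ[X] →ₗ[ℝ] ℝ) (s : Finset ℕ) (x : ℕ → ℝ) (f : ℕ → ℝ[X]) (q : ℝ[X]) :
    L ((∑ k ∈ s, C (x k) * f k) * q) = ∑ k ∈ s, x k * L (f k * q) := by
  rw [Finset.sum_mul, map_sum]
  exact Finset.sum_congr rfl fun k _ => by rw [mul_assoc, map_C_mul]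

theorem map_sum_C_mul_mul_self (L : ℝ[X] →ₗ[ℝ] ℝ) (s : Finset ℕ) (x : ℕ → ℝ) (f : ℕ → ℝ[X]) :
    L ((∑ k ∈ s, C (x k) * f k) * ∑ k ∈ s, C (x k) * f k) =
      ∑ k ∈ s, ∑ l ∈ s, x k * x l * L (f k * f l) := by
  rw [map_sum_C_mul_mul]
  refine Finset.sum_congr rfl fun k _ => ?_
  rw [mul_comm (f k), map_sum_C_mul_mul, Finset.mul_sum]
  exact Finset.sum_congr rfl fun l _ => by rw [mul_comm (f l), mul_assoc]

theorem derivative_sum_C_mul (s : Finset ℕ) (x : ℕ → ℝ) (f : ℕ → ℝ[X]) :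
    derivative (∑ k ∈ s, C (x k) * f k) = ∑ k ∈ s, C (x k) * derivative (f k) := by
  simp

theorem IsGegenbauerFunctional.map_expansion_sq (hlam : -(1 / 2 : ℝ) < lam)
    (hL : IsGegenbauerFunctional lam L) (s : Finset ℕ) (x : ℕ → ℝ) :
    L ((∑ k ∈ s, C (x k) * U k) * ∑ k ∈ s, C (x k) * U k) =
      ∑ k ∈ s, x k ^ 2 * L (U k * U k) := by
  rw [map_sum_C_mul_mul_self]
  refine Finset.sum_congr rfl fun k hk => ?_
  rw [Finset.sum_eq_single_of_mem k hk]
  · ring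
  · intro l _ hl
    rw [hL.map_mul_of_ne hlam hl.symm, mul_zero]

theorem IsGegenbauerFunctional.map_sq_pos (hlam : -(1 / 2 : ℝ) < lam)
    (hL : IsGegenbauerFunctional lam L) (h1 : 0 < L 1) {p : ℝ[X]} (hp : p ≠ 0) :
    0 < L (p * p) := by
  obtain ⟨x, hx⟩ := exists_gegenbauerPoly_expansion hlam p.natDegree p le_rfl
  have hex : ∃ k ∈ Finset.range (p.natDegree + 1), x k ≠ 0 := by
    by_contra! h
    apply hp
    rw [hx]
    exact Finset.sum_eq_zero fun k hk => by rw [h k hk, C_0, zero_mul]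
  rw [hx, hL.map_expansion_sq hlam]
  obtain ⟨k, hk, hxk⟩ := hex
  refine Finset.sum_pos' (fun j _ => ?_) ⟨k, hk, ?_⟩
  · exact mul_nonneg (sq_nonneg _) (hL.norm_sq_pos hlam h1 j).le
  · exact mul_pos (by positivity) (hL.norm_sq_pos hlam h1 k)

/-- Parseval's identity for the Gegenbauer polynomials. -/
theorem IsGegenbauerFunctional.map_mul_eq_sum (hlam : -(1 / 2 : ℝ) < lam)
    (hL : IsGegenbauerFunctional lam L) (h1 : 0 < L 1) (n : ℕ) (p q : ℝ[X])
    (hp : p.natDegree ≤ n) :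
    L (p * q) = ∑ j ∈ Finset.range (n + 1), L (p * U j) * L (q * U j) / L (U j * U j) := by
  obtain ⟨x, hx⟩ := exists_gegenbauerPoly_expansion hlam n p hp
  conv_lhs => rw [hx]
  rw [map_sum_C_mul_mul]
  refine Finset.sum_congr rfl fun j hj => ?_
  have hpj : L (p * U j) = x j * L (U j * U j) := by
    rw [hx, map_sum_C_mul_mul, Finset.sum_eq_single_of_mem j hj]
    intro l _ hl
    rw [hL.map_mul_of_ne hlam hl, mul_zero]
  have := (hL.norm_sq_pos hlam h1 j).ne'
  rw [hpj, mul_comm (U j) q]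
  field_simp

/-- If `c` bounds the Rayleigh quotients of the Gram matrix `A` of the derivatives, then
`tr (A ^ 2) ≤ c * tr A`. -/
theorem IsGegenbauerFunctional.trace_sq_le (hlam : -(1 / 2 : ℝ) < lam)
    (hL : IsGegenbauerFunctional lam L) (h1 : 0 < L 1) (n : ℕ) (s : Finset ℕ)
    (hs : ∀ k ∈ s, k ≤ n) (c : ℝ)
    (hc : ∀ p : ℝ[X], p.natDegree ≤ n → L (derivative p * derivative p) ≤ c * L (p * p)) :
    ∑ k ∈ s, ∑ l ∈ s, L (derivative (U k) * derivative (U l)) ^ 2 /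
        (L (U k * U k) * L (U l * U l)) ≤
      c * ∑ k ∈ s, L (derivative (U k) * derivative (U k)) / L (U k * U k) := by
  have hpos := hL.norm_sq_pos hlam h1
  set D : ℕ → ℕ → ℝ := fun k j => L (derivative (U k) * U j) with hD
  have hparseval : ∀ k ∈ s, ∀ l, L (derivative (U k) * derivative (U l)) =
      ∑ j ∈ Finset.range (n + 1), D k j * D l j / L (U j * U j) := fun k hk l =>
    hL.map_mul_eq_sum hlam h1 n _ _ ((natDegree_derivative_le _).trans
      ((Nat.sub_le _ _).trans ((gegenbauerPoly_natDegree_le lam k).trans (hs k hk))))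
  -- By Parseval A = B Bᵀ, with B the normalized `D`. Testing the bound on each column of B and
  -- summing gives tr(Bᵀ A B) ≤ c tr(Bᵀ B), that is, tr(A²) ≤ c tr A, without any spectral theorem.
  have hrow : ∀ j, ∑ k ∈ s, ∑ l ∈ s, D k j / L (U k * U k) * (D l j / L (U l * U l)) *
      L (derivative (U k) * derivative (U l)) ≤ c * ∑ k ∈ s, D k j ^ 2 / L (U k * U k) := by
    intro j
    have h := hc (∑ k ∈ s, C (D k j / L (U k * U k)) * U k) (natDegree_sum_le_of_forall_le _ _
      fun k hk => (natDegree_C_mul_le _ _).trans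
        ((gegenbauerPoly_natDegree_le lam k).trans (hs k hk)))
    rw [derivative_sum_C_mul, map_sum_C_mul_mul_self L s _ (fun k => derivative (U k)),
      hL.map_expansion_sq hlam] at h
    refine h.trans_eq (congrArg (c * ·) (Finset.sum_congr rfl fun k _ => ?_))
    have := (hpos k).ne'
    field_simp
  have hsum := Finset.sum_le_sum fun j (_ : j ∈ Finset.range (n + 1)) =>
    div_le_div_of_nonneg_right (hrow j) (hpos j).le
  refine (le_of_eq ?_).trans (hsum.trans_eq ?_)
  · simp only [Finset.sum_div]
    refine Eq.symm ?_
    rw [Finset.sum_comm]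
    refine Finset.sum_congr rfl fun k hk => ?_
    rw [Finset.sum_comm]
    refine Finset.sum_congr rfl fun l hl => Eq.symm ?_
    have h := hparseval k hk l
    rw [sq]
    nth_rewrite 1 [h]
    rw [Finset.sum_mul, Finset.sum_div]
    refine Finset.sum_congr rfl fun j _ => ?_
    have := (hpos k).ne'
    have := (hpos l).ne'
    have := (hpos j).ne'
    field_simp
  · simp only [mul_div_assoc, ← Finset.mul_sum]
    congr 1
    simp only [Finset.sum_div]
    refine Eq.symm ?_
    rw [Finset.sum_comm]
    refine Finset.sum_congr rfl fun k hk => Eq.symm ?_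
    rw [hparseval k hk k, Finset.sum_div]
    refine Finset.sum_congr rfl fun j _ => ?_
    ring

/-- A quadratic form is bounded by the Frobenius norm of its matrix: Cauchy–Schwarz over the pairs
(k, l). -/
theorem IsGegenbauerFunctional.derivative_norm_sq_le (hlam : -(1 / 2 : ℝ) < lam)
    (hL : IsGegenbauerFunctional lam L) (h1 : 0 < L 1) (s : Finset ℕ) (x : ℕ → ℝ) (b : ℝ)
    (hb : 0 ≤ b)
    (hs : ∑ k ∈ s, ∑ l ∈ s, L (derivative (U k) * derivative (U l)) ^ 2 /
        (L (U k * U k) * L (U l * U l)) ≤ b ^ 2) :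
    L (derivative (∑ k ∈ s, C (x k) * U k) * derivative (∑ k ∈ s, C (x k) * U k)) ≤
      b * L ((∑ k ∈ s, C (x k) * U k) * ∑ k ∈ s, C (x k) * U k) := by
  have hpos := hL.norm_sq_pos hlam h1
  rw [derivative_sum_C_mul, map_sum_C_mul_mul_self L s _ (fun k => derivative (U k)),
    hL.map_expansion_sq hlam]
  set N := ∑ k ∈ s, x k ^ 2 * L (U k * U k) with hN
  have hN0 : 0 ≤ N := Finset.sum_nonneg fun k _ => mul_nonneg (sq_nonneg _) (hpos k).le
  refine abs_le_of_sq_le_sq' ?_ (mul_nonneg hb hN0) |>.2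
  rw [← Finset.sum_product' s s (fun k l => x k * x l * L (derivative (U k) * derivative (U l)))]
  rw [← Finset.sum_product' s s (fun k l => L (derivative (U k) * derivative (U l)) ^ 2 /
        (L (U k * U k) * L (U l * U l)))] at hs
  have hcs := Finset.sum_sq_le_sum_mul_sum_of_sq_le_mul (s ×ˢ s)
    (r := fun a => x a.1 * x a.2 * L (derivative (U a.1) * derivative (U a.2)))
    (f := fun a => L (derivative (U a.1) * derivative (U a.2)) ^ 2 /
        (L (U a.1 * U a.1) * L (U a.2 * U a.2)))
    (g := fun a => x a.1 ^ 2 * L (U a.1 * U a.1) * (x a.2 ^ 2 * L (U a.2 * U a.2)))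
    (fun a _ => div_nonneg (sq_nonneg _) (mul_pos (hpos _) (hpos _)).le)
    (fun a _ => mul_nonneg (mul_nonneg (sq_nonneg _) (hpos _).le)
      (mul_nonneg (sq_nonneg _) (hpos _).le))
    (fun a _ => by
      have := (hpos a.1).ne'
      have := (hpos a.2).ne'
      apply le_of_eq
      field_simp)
  have hNN : ∑ a ∈ s ×ˢ s, x a.1 ^ 2 * L (U a.1 * U a.1) * (x a.2 ^ 2 * L (U a.2 * U a.2)) =
      N ^ 2 := by
    rw [Finset.sum_product, sq, hN, Finset.sum_mul_sum]
  rw [hNN] at hcs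
  rw [mul_pow]
  exact hcs.trans (mul_le_mul_of_nonneg_right hs (sq_nonneg N))

end Expansion

/-! ### Closed forms for the trace and the Frobenius norm -/

section Traces

open Polynomial

/-- The numbers at most `n` of the parity of `n`. -/
def sameParity (n : ℕ) : Finset ℕ := (Finset.range (n + 1)).filter (fun k => k % 2 = n % 2)

theorem mem_sameParity {n k : ℕ} : k ∈ sameParity n ↔ k ≤ n ∧ k % 2 = n % 2 := by
  simp [sameParity]

theorem sameParity_add_two (n : ℕ) : sameParity (n + 2) = insert (n + 2) (sameParity n) := by
  ext k
  simp only [Finset.mem_insert, mem_sameParity]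
  omega

theorem add_two_notMem_sameParity (n : ℕ) : n + 2 ∉ sameParity n := by
  rw [mem_sameParity]; omega

theorem sameParity_zero : sameParity 0 = {0} := by decide

theorem sameParity_one : sameParity 1 = {1} := by decide

theorem sum_sameParity_add_two (n : ℕ) (f : ℕ → ℝ) :
    ∑ k ∈ sameParity (n + 2), f k = f (n + 2) + ∑ k ∈ sameParity n, f k := by
  rw [sameParity_add_two, Finset.sum_insert (add_two_notMem_sameParity n)]

theorem sum_derivativeEnergy (lam : ℝ) (n : ℕ) :
    4 * ∑ k ∈ sameParity n, derivativeEnergy lam k =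
      (((n : ℝ) + lam + 1) ^ 2 - 1 - lam ^ 2) ^ 2 - if n % 2 = 0 then 4 * lam ^ 2 else 1 := by
  induction n using Nat.twoStepInduction with
  | zero => simp [sameParity_zero, derivativeEnergy]; ring
  | one => simp [sameParity_one, derivativeEnergy]; ring
  | more n ih _ =>
    rw [sum_sameParity_add_two, mul_add, ih, Nat.add_mod_right, derivativeEnergy]
    push_cast
    ring

/-- The quadratic factor in the closed form of the partial sums `∑ k < l, S k ^ 2 * h k`. -/
noncomputable def energySumFactor (lam v : ℝ) : ℝ :=
  2 * (2 * lam + 3) * v ^ 2 -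
    ((2 * lam + 1) ^ 3 + 4 * (2 * lam + 1) ^ 2 + 5 * (2 * lam + 1) + 10) * v +
    (9 / 4 + 41 / 8 * (2 * lam + 1) + 4 * (2 * lam + 1) ^ 2 + 7 / 4 * (2 * lam + 1) ^ 3 +
      3 / 4 * (2 * lam + 1) ^ 4 + 1 / 8 * (2 * lam + 1) ^ 5)

/-- The closed form of `∑ k < x, S k ^ 2 * h k / h x` over `k` of the parity of `x`, up to the
factor `(2 * lam + 3) * (2 * lam + 5)`. -/
noncomputable def energySum (lam x : ℝ) : ℝ :=
  x * (x - 1) * (x + lam) * energySumFactor lam ((x + lam - 1) ^ 2)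

variable {lam : ℝ} {L : ℝ[X] →ₗ[ℝ] ℝ}

local notation "U" => gegenbauerPoly lam

/-- The right side is `energySum` at x + 2 times the ratio h_{x+2} / h_x, so the weighted partial
sums telescope. -/
theorem energySum_add_two (lam x : ℝ) :
    (2 * lam + 3) * (2 * lam + 5) * derivativeEnergy lam x ^ 2 + energySum lam x =
      (x + lam) * (x + 2 * lam) * (x + 1 + 2 * lam) *
        energySumFactor lam ((x + 1 + lam) ^ 2) := by
  simp only [derivativeEnergy, energySum, energySumFactor]
  ring

theorem IsGegenbauerFunctional.norm_sq_add_three (hlam : -(1 / 2 : ℝ) < lam)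
    (hL : IsGegenbauerFunctional lam L) (k : ℕ) :
    ((k : ℝ) + 1 + lam) * (k + 1 + 2 * lam) * (k + 2 + 2 * lam) * L (U (k + 1) * U (k + 1)) =
      (k + 2) * (k + 3) * (k + 3 + lam) * L (U (k + 3) * U (k + 3)) := by
  have h := hL.norm_sq_add_two hlam k
  have h' := hL.norm_sq_add_two hlam (k + 1)
  have hk : (0 : ℝ) ≤ k := Nat.cast_nonneg k
  push_cast at h'
  refine mul_left_cancel₀ (show (k : ℝ) + 2 + lam ≠ 0 by linarith) ?_
  linear_combination (-((k : ℝ) + 2 + lam) * (k + 2 + 2 * lam)) * h - (k + 2) * (k + 2 + lam) * h'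

theorem IsGegenbauerFunctional.energySum_mul (hlam : -(1 / 2 : ℝ) < lam)
    (hL : IsGegenbauerFunctional lam L) (k : ℕ) :
    ((2 * lam + 3) * (2 * lam + 5) * derivativeEnergy lam (k + 1) ^ 2 + energySum lam (k + 1)) *
        L (U (k + 1) * U (k + 1)) = energySum lam (k + 3) * L (U (k + 3) * U (k + 3)) := by
  rw [energySum_add_two, energySum, show (k : ℝ) + 3 + lam - 1 = k + 1 + 1 + lam by ring]
  linear_combination energySumFactor lam (((k : ℝ) + 1 + 1 + lam) ^ 2) *
    hL.norm_sq_add_three hlam k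

theorem IsGegenbauerFunctional.sum_energy_sq (hlam : -(1 / 2 : ℝ) < lam)
    (hL : IsGegenbauerFunctional lam L) (n : ℕ) :
    (2 * lam + 3) * (2 * lam + 5) *
        ∑ k ∈ sameParity n, derivativeEnergy lam k ^ 2 * L (U k * U k) =
      energySum lam (n + 2) * L (U (n + 2) * U (n + 2)) := by
  induction n using Nat.twoStepInduction with
  | zero =>
    have h : energySum lam 2 = 0 := by
      simp only [energySum, energySumFactor]
      ring
    simp [sameParity_zero, derivativeEnergy, h]
  | one =>
    have h := hL.energySum_mul hlam 0
    have h1 : energySum lam 1 = 0 := by simp [energySum]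
    norm_num [h1] at h
    rw [sameParity_one, Finset.sum_singleton]
    norm_num
    linear_combination h
  | more n ih _ =>
    have h := hL.energySum_mul hlam (n + 1)
    rw [sum_sameParity_add_two, mul_add, ih]
    push_cast at h ⊢
    rw [show (n : ℝ) + 1 + 1 = n + 2 by ring, show (n : ℝ) + 1 + 3 = n + 2 + 2 by ring] at h
    linear_combination h

/-- The squared Frobenius norm of the Gram matrix of the derivatives of the normalized Gegenbauer
polynomials of degree at most `n` and of the parity of `n`. -/
noncomputable def gramSq (lam : ℝ) (L : ℝ[X] →ₗ[ℝ] ℝ) (n : ℕ) : ℝ :=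
  ∑ k ∈ sameParity n, ∑ l ∈ sameParity n,
    L (derivative (gegenbauerPoly lam k) * derivative (gegenbauerPoly lam l)) ^ 2 /
      (L (gegenbauerPoly lam k * gegenbauerPoly lam k) *
        L (gegenbauerPoly lam l * gegenbauerPoly lam l))

theorem IsGegenbauerFunctional.gram_eq (hlam : -(1 / 2 : ℝ) < lam)
    (hL : IsGegenbauerFunctional lam L) {k n : ℕ} (hk : k ∈ sameParity n) :
    L (derivative (U k) * derivative (U n)) =
      derivativeEnergy lam k * L (U k * U k) / (2 * lam + 1) := by
  obtain ⟨hkn, hpar⟩ := mem_sameParity.mp hk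
  obtain ⟨i, rfl⟩ : ∃ i, n = k + 2 * i := ⟨(n - k) / 2, by omega⟩
  rw [hL.map_derivative_mul_derivative_of_le hlam, ← hL.derivative_norm_sq hlam,
    mul_div_cancel_left₀ _ (by linarith)]

theorem self_mem_sameParity (n : ℕ) : n ∈ sameParity n := mem_sameParity.mpr ⟨le_rfl, rfl⟩

theorem mem_sameParity_add_two {k n : ℕ} (hk : k ∈ sameParity n) : k ∈ sameParity (n + 2) := by
  rw [sameParity_add_two]
  exact Finset.mem_insert_of_mem hk

/-- Passing to n + 2 borders the matrix by one row and one column: one diagonal entry, and twice the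
off-diagonal squares, summed by `sum_energy_sq`. -/
theorem IsGegenbauerFunctional.gramSq_add_two (hlam : -(1 / 2 : ℝ) < lam)
    (hL : IsGegenbauerFunctional lam L) (h1 : 0 < L 1) (n : ℕ) :
    (2 * lam + 1) ^ 2 * ((2 * lam + 3) * (2 * lam + 5)) * gramSq lam L (n + 2) =
      (2 * lam + 1) ^ 2 * ((2 * lam + 3) * (2 * lam + 5)) * gramSq lam L n +
        (2 * lam + 3) * (2 * lam + 5) * derivativeEnergy lam (n + 2) ^ 2 +
        2 * energySum lam (n + 2) := by
  have hpos := hL.norm_sq_pos hlam h1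
  have hs : 2 * lam + 1 ≠ 0 := by linarith
  have hne := (hpos (n + 2)).ne'
  have hdiag : (2 * lam + 1) ^ 2 * (L (derivative (U (n + 2)) * derivative (U (n + 2))) ^ 2 /
      (L (U (n + 2) * U (n + 2)) * L (U (n + 2) * U (n + 2)))) =
      derivativeEnergy lam (n + 2) ^ 2 := by
    rw [hL.gram_eq hlam (self_mem_sameParity (n + 2))]
    push_cast
    field_simp
  have hoff : (2 * lam + 1) ^ 2 * ((2 * lam + 3) * (2 * lam + 5)) * ∑ k ∈ sameParity n,
      L (derivative (U k) * derivative (U (n + 2))) ^ 2 /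
        (L (U k * U k) * L (U (n + 2) * U (n + 2))) = energySum lam (n + 2) := by
    have h : ∀ k ∈ sameParity n, L (derivative (U k) * derivative (U (n + 2))) ^ 2 /
        (L (U k * U k) * L (U (n + 2) * U (n + 2))) =
        derivativeEnergy lam k ^ 2 * L (U k * U k) *
          ((2 * lam + 1) ^ 2 * L (U (n + 2) * U (n + 2)))⁻¹ := by
      intro k hk
      have := (hpos k).ne'
      rw [hL.gram_eq hlam (mem_sameParity_add_two hk)]
      field_simp
    rw [Finset.sum_congr rfl h, ← Finset.sum_mul]
    have e := hL.sum_energy_sq hlam n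
    rw [← mul_right_cancel_iff_of_pos (hpos (n + 2)), ← e]
    field_simp
  have hoff' : ∑ k ∈ sameParity n, L (derivative (U (n + 2)) * derivative (U k)) ^ 2 /
        (L (U (n + 2) * U (n + 2)) * L (U k * U k)) = ∑ k ∈ sameParity n,
      L (derivative (U k) * derivative (U (n + 2))) ^ 2 /
        (L (U k * U k) * L (U (n + 2) * U (n + 2))) :=
    Finset.sum_congr rfl fun k _ => by
      rw [mul_comm (derivative (U k)), mul_comm (L (U k * U k))]
  unfold gramSq
  rw [sum_sameParity_add_two, sum_sameParity_add_two]
  simp only [sum_sameParity_add_two n (fun l => L (derivative (U _) * derivative (U l)) ^ 2 /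
      (L (U _ * U _) * L (U l * U l))), Finset.sum_add_distrib]
  rw [hoff']
  linear_combination (2 * lam + 3) * (2 * lam + 5) * hdiag + 2 * hoff

theorem gramSq_zero : gramSq lam L 0 = 0 := by
  simp [gramSq, sameParity_zero, gegenbauerPoly]

theorem IsGegenbauerFunctional.gramSq_one (hlam : -(1 / 2 : ℝ) < lam)
    (hL : IsGegenbauerFunctional lam L) (h1 : 0 < L 1) :
    gramSq lam L 1 = (2 + 2 * lam) ^ 2 := by
  have h := (hL.norm_sq_pos hlam h1 1).ne'
  have hs : 2 * lam + 1 ≠ 0 := by linarith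
  rw [gramSq, sameParity_one, Finset.sum_singleton, Finset.sum_singleton,
    hL.gram_eq hlam (self_mem_sameParity 1), derivativeEnergy]
  push_cast
  field_simp
  ring

end Traces

/-! ### The weighted integral as a functional -/

section Integration

open Polynomial MeasureTheory Set

/-- On [0, 1] the only possible singularity is that of (1 - t)^(λ - 1/2), whose exponent exceeds -1;
the other half follows by evenness. -/
theorem gegenbauerWeight_intervalIntegrable {lam : ℝ} (hlam : -(1 / 2 : ℝ) < lam) :
    IntervalIntegrable (gegenbauerWeight lam) volume (-1) 1 := by
  have hr : -1 < lam - 1 / 2 := by linarith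
  have h01 : IntervalIntegrable (gegenbauerWeight lam) volume 0 1 := by
    have h1 : IntervalIntegrable (fun t : ℝ => (1 - t) ^ (lam - 1 / 2)) volume 0 1 := by
      have := (intervalIntegral.intervalIntegrable_rpow' (a := 0) (b := 1) hr).comp_sub_left 1
      simpa using this.symm
    have h2 : ContinuousOn (fun t : ℝ => (1 + t) ^ (lam - 1 / 2)) (uIcc 0 1) := by
      intro t ht
      rw [uIcc_of_le zero_le_one] at ht
      refine ContinuousAt.continuousWithinAt (ContinuousAt.rpow_const (by fun_prop) (Or.inl ?_))
      linarith [ht.1]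
    refine (h1.mul_continuousOn h2).congr ?_
    intro t ht
    rw [uIoc_of_le zero_le_one] at ht
    change (1 - t) ^ (lam - 1 / 2) * (1 + t) ^ (lam - 1 / 2) = gegenbauerWeight lam t
    rw [gegenbauerWeight, ← Real.mul_rpow (by linarith [ht.2]) (by linarith [ht.1])]
    ring_nf
  have h10 : IntervalIntegrable (gegenbauerWeight lam) volume (-1) 0 := by
    have := (IntervalIntegrable.iff_comp_neg (by finiteness)).mp h01
    simp only [neg_zero, gegenbauerWeight, neg_sq] at this
    exact this.symm
  exact h10.trans h01

theorem gegenbauerWeight_mul_intervalIntegrable {lam : ℝ} (hlam : -(1 / 2 : ℝ) < lam) (p : ℝ[X]) :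
    IntervalIntegrable (fun t => gegenbauerWeight lam t * p.eval t) volume (-1) 1 :=
  (gegenbauerWeight_intervalIntegrable hlam).mul_continuousOn p.continuous.continuousOn

/-- Integration against the Gegenbauer weight. -/
noncomputable def gegenbauerFunctional {lam : ℝ} (hlam : -(1 / 2 : ℝ) < lam) : ℝ[X] →ₗ[ℝ] ℝ where
  toFun p := ∫ t in (-1 : ℝ)..1, gegenbauerWeight lam t * p.eval t
  map_add' p q := by
    rw [← intervalIntegral.integral_add (gegenbauerWeight_mul_intervalIntegrable hlam p)
      (gegenbauerWeight_mul_intervalIntegrable hlam q)]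
    simp only [eval_add, mul_add]
  map_smul' c p := by
    rw [RingHom.id_apply, smul_eq_mul, ← intervalIntegral.integral_const_mul]
    simp only [eval_smul, smul_eq_mul, mul_left_comm]

theorem gegenbauerFunctional_one_pos {lam : ℝ} (hlam : -(1 / 2 : ℝ) < lam) :
    0 < gegenbauerFunctional hlam 1 := by
  refine intervalIntegral.intervalIntegral_pos_of_pos_on
    (gegenbauerWeight_mul_intervalIntegrable hlam 1) (fun t ht => ?_) (by norm_num)
  rw [eval_one, mul_one]
  exact Real.rpow_pos_of_pos (by nlinarith [ht.1, ht.2]) _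

/-- The integrand is the derivative of (1 - t²)^(λ + 1/2) q(t), which vanishes at ±1 because λ + 1/2
> 0. -/
theorem gegenbauerFunctional_integration_by_parts {lam : ℝ} (hlam : -(1 / 2 : ℝ) < lam)
    (q : ℝ[X]) :
    gegenbauerFunctional hlam
      ((1 - X ^ 2) * derivative q - C (2 * lam + 1) * (X * q)) = 0 := by
  have hcont : ContinuousOn (fun t : ℝ => (1 - t ^ 2) ^ (lam + 1 / 2) * q.eval t) (Icc (-1) 1) :=
    ContinuousOn.mul (ContinuousOn.rpow_const (by fun_prop) fun t _ => Or.inr (by linarith))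
      q.continuous.continuousOn
  have hderiv : ∀ t ∈ Ioo (-1 : ℝ) 1,
      HasDerivAt (fun t : ℝ => (1 - t ^ 2) ^ (lam + 1 / 2) * q.eval t)
        (gegenbauerWeight lam t *
          ((1 - X ^ 2) * derivative q - C (2 * lam + 1) * (X * q)).eval t) t := by
    intro t ht
    have hpos : 0 < 1 - t ^ 2 := by nlinarith [ht.1, ht.2]
    have h1 : HasDerivAt (fun t : ℝ => 1 - t ^ 2) (-(2 * t)) t := by
      simpa using (hasDerivAt_pow 2 t).const_sub 1
    have h2 := (h1.rpow_const (p := lam + 1 / 2) (Or.inl hpos.ne')).mul (q.hasDerivAt t)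
    refine h2.congr_deriv ?_
    have e1 : lam + 1 / 2 - 1 = lam - 1 / 2 := by ring
    have e2 : (1 - t ^ 2) ^ (lam + 1 / 2) = (1 - t ^ 2) ^ (lam - 1 / 2) * (1 - t ^ 2) := by
      rw [← Real.rpow_add_one hpos.ne']
      congr 1
      ring
    rw [e1, e2, gegenbauerWeight]
    simp only [eval_sub, eval_mul, eval_one, eval_pow, eval_X, eval_C]
    ring
  have h := intervalIntegral.integral_eq_sub_of_hasDerivAt_of_le (by norm_num) hcont hderiv
    (gegenbauerWeight_mul_intervalIntegrable hlam _)
  have h0 : lam + 1 / 2 ≠ 0 := by linarith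
  refine h.trans ?_
  norm_num [Real.zero_rpow h0]

end Integration

/-! ### Polynomial inequalities and the bounds for the functional -/

section Estimates

open Polynomial

theorem upper_bound_step {lam x : ℝ} (hlam : -(1 / 2 : ℝ) < lam) (hx : 0 ≤ x) :
    4 * ((2 * lam + 3) * (2 * lam + 5) * derivativeEnergy lam (x + 2) ^ 2 +
        2 * energySum lam (x + 2)) ≤
      (2 * lam + 3) * ((x + 2 + 5 / 4 * lam + 9 / 8) ^ 8 - (x + 5 / 4 * lam + 9 / 8) ^ 8) := by
  -- In s > 0 and x ≥ 0 the difference of the two sides expands with nonnegative coefficients only.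
  obtain ⟨s, hs, rfl⟩ : ∃ s : ℝ, 0 < s ∧ lam = (s - 1) / 2 := ⟨2 * lam + 1, by linarith, by ring⟩
  rw [← sub_nonneg]
  simp only [derivativeEnergy, energySum, energySumFactor]
  ring_nf
  positivity

/-- The numerator in the lower estimate. -/
noncomputable def lowerNumerator (lam x : ℝ) : ℝ := (x + 1) * (x + lam + 1 / 2) ^ 2 * (x + 2 * lam)

/-- The two values of `c` are the parity remainders in `sum_derivativeEnergy`; the subtracted terms
are increments of numerator times trace. -/
theorem lower_bound_step {lam x c : ℝ} (hlam : -(1 / 2 : ℝ) < lam) (hx : 0 ≤ x)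
    (hc : c = 4 * lam ^ 2 ∨ c = 1) :
    (2 * lam + 3) * (lowerNumerator lam (x + 2) * (((x + 2 + lam + 1) ^ 2 - 1 - lam ^ 2) ^ 2 - c) -
        lowerNumerator lam x * (((x + lam + 1) ^ 2 - 1 - lam ^ 2) ^ 2 - c)) ≤
      4 * ((2 * lam + 3) * (2 * lam + 5) * derivativeEnergy lam (x + 2) ^ 2 +
        2 * energySum lam (x + 2)) := by
  obtain ⟨s, hs, rfl⟩ : ∃ s : ℝ, 0 < s ∧ lam = (s - 1) / 2 := ⟨2 * lam + 1, by linarith, by ring⟩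
  rw [← sub_nonneg]
  simp only [derivativeEnergy, energySum, energySumFactor, lowerNumerator]
  rcases hc with rfl | rfl
  · ring_nf
    positivity
  · ring_nf
    positivity

variable {lam : ℝ} {L : ℝ[X] →ₗ[ℝ] ℝ}

local notation "U" => gegenbauerPoly lam

theorem IsGegenbauerFunctional.gramSq_le (hlam : -(1 / 2 : ℝ) < lam)
    (hL : IsGegenbauerFunctional lam L) (h1 : 0 < L 1) (n : ℕ) :
    4 * ((2 * lam + 1) ^ 2 * (2 * lam + 5)) * gramSq lam L n ≤
      ((n : ℝ) + 5 / 4 * lam + 9 / 8) ^ 8 := by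
  induction n using Nat.twoStepInduction with
  | zero =>
    rw [gramSq_zero, mul_zero]
    exact Even.pow_nonneg (by decide) _
  | one =>
    rw [hL.gramSq_one hlam h1]
    obtain ⟨s, hs, rfl⟩ : ∃ s : ℝ, 0 < s ∧ lam = (s - 1) / 2 :=
      ⟨2 * lam + 1, by linarith, by ring⟩
    push_cast
    rw [← sub_nonneg]
    ring_nf
    positivity
  | more n ih _ =>
    have h := hL.gramSq_add_two hlam h1 n
    have hstep := upper_bound_step hlam (Nat.cast_nonneg n : (0 : ℝ) ≤ n)
    have h3 : 0 < 2 * lam + 3 := by linarith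
    refine le_of_mul_le_mul_left ?_ h3
    push_cast
    linear_combination 4 * h + hstep + (2 * lam + 3) * ih

theorem IsGegenbauerFunctional.le_gramSq (hlam : -(1 / 2 : ℝ) < lam)
    (hL : IsGegenbauerFunctional lam L) (h1 : 0 < L 1) (n : ℕ) :
    lowerNumerator lam n * ∑ k ∈ sameParity n, derivativeEnergy lam k ≤
      (2 * lam + 1) ^ 2 * (2 * lam + 5) * gramSq lam L n := by
  induction n using Nat.twoStepInduction with
  | zero => simp [gramSq_zero, sameParity_zero, derivativeEnergy]
  | one =>
    rw [hL.gramSq_one hlam h1, sameParity_one, Finset.sum_singleton]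
    simp only [derivativeEnergy, lowerNumerator]
    obtain ⟨s, hs, rfl⟩ : ∃ s : ℝ, 0 < s ∧ lam = (s - 1) / 2 :=
      ⟨2 * lam + 1, by linarith, by ring⟩
    push_cast
    rw [← sub_nonneg]
    ring_nf
    positivity
  | more n ih _ =>
    have h := hL.gramSq_add_two hlam h1 n
    have hstep := lower_bound_step (c := if n % 2 = 0 then 4 * lam ^ 2 else 1) hlam
      (Nat.cast_nonneg n : (0 : ℝ) ≤ n) (by split_ifs <;> simp)
    have hs := sum_derivativeEnergy lam n
    have hs2 := sum_derivativeEnergy lam (n + 2)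
    rw [Nat.add_mod_right] at hs2
    push_cast at hs2
    rw [← hs, ← hs2] at hstep
    have h3 : 0 < 2 * lam + 3 := by linarith
    refine le_of_mul_le_mul_left ?_ h3
    push_cast
    linear_combination -h + hstep / 4 + (2 * lam + 3) * ih

theorem sum_derivativeEnergy_pos (hlam : -(1 / 2 : ℝ) < lam) {n : ℕ} (hn : 1 ≤ n) :
    0 < ∑ k ∈ sameParity n, derivativeEnergy lam k := by
  have hpos : ∀ k : ℕ, 1 ≤ k → 0 < derivativeEnergy lam k := by
    intro k hk
    have : (1 : ℝ) ≤ k := by exact_mod_cast hk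
    exact mul_pos (mul_pos (by linarith) (by linarith)) (by linarith)
  refine Finset.sum_pos' (fun k _ => ?_) ⟨n, self_mem_sameParity n, hpos n hn⟩
  rcases Nat.eq_zero_or_pos k with rfl | hk
  · simp [derivativeEnergy]
  · exact (hpos k hk).le

theorem IsGegenbauerFunctional.lower_bound (hlam : -(1 / 2 : ℝ) < lam)
    (hL : IsGegenbauerFunctional lam L) (h1 : 0 < L 1) {n : ℕ} (hn : 1 ≤ n) (c : ℝ)
    (hc : ∀ p : ℝ[X], p.natDegree ≤ n → L (derivative p * derivative p) ≤ c * L (p * p)) :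
    ((n : ℝ) + 1) * ((n : ℝ) + lam + 1 / 2) ^ 2 * ((n : ℝ) + 2 * lam) /
      ((2 * lam + 1) * (2 * lam + 5)) ≤ c := by
  have hs : 0 < 2 * lam + 1 := by linarith
  have htr := hL.trace_sq_le hlam h1 n (sameParity n) (fun k hk => (mem_sameParity.mp hk).1) c hc
  have hdiag : ∑ k ∈ sameParity n, L (derivative (U k) * derivative (U k)) / L (U k * U k) =
      (∑ k ∈ sameParity n, derivativeEnergy lam k) / (2 * lam + 1) := by
    rw [Finset.sum_div]
    refine Finset.sum_congr rfl fun k _ => ?_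
    have := (hL.norm_sq_pos hlam h1 k).ne'
    rw [hL.gram_eq hlam (self_mem_sameParity k)]
    field_simp
  rw [hdiag] at htr
  have hF := sum_derivativeEnergy_pos hlam hn
  have hlow := hL.le_gramSq hlam h1 n
  set F := ∑ k ∈ sameParity n, derivativeEnergy lam k
  rw [div_le_iff₀ (mul_pos hs (by linarith))]
  refine le_of_mul_le_mul_right ?_ hF
  calc _ = lowerNumerator lam n * F := rfl
    _ ≤ (2 * lam + 1) ^ 2 * (2 * lam + 5) * gramSq lam L n := hlow
    _ ≤ (2 * lam + 1) ^ 2 * (2 * lam + 5) * (c * (F / (2 * lam + 1))) :=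
      mul_le_mul_of_nonneg_left htr (mul_pos (by positivity) (by linarith)).le
    _ = c * ((2 * lam + 1) * (2 * lam + 5)) * F := by
      field_simp

/-- The parity parts of a polynomial do not interact, so each block can be bounded separately by its
own Frobenius norm. -/
theorem IsGegenbauerFunctional.map_blocks (hlam : -(1 / 2 : ℝ) < lam)
    (hL : IsGegenbauerFunctional lam L) (n : ℕ) (x : ℕ → ℝ) :
    L ((∑ k ∈ sameParity (n + 1), C (x k) * U k) * ∑ k ∈ sameParity n, C (x k) * U k) = 0 ∧
    L (derivative (∑ k ∈ sameParity (n + 1), C (x k) * U k) *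
      derivative (∑ k ∈ sameParity n, C (x k) * U k)) = 0 := by
  have hpar : ∀ k ∈ sameParity (n + 1), ∀ l ∈ sameParity n, k % 2 ≠ l % 2 := by
    intro k hk l hl
    rw [mem_sameParity] at hk hl
    omega
  rw [derivative_sum_C_mul, derivative_sum_C_mul, map_sum_C_mul_mul, map_sum_C_mul_mul]
  constructor
  · refine Finset.sum_eq_zero fun k hk => ?_
    rw [mul_comm (U k), map_sum_C_mul_mul, Finset.sum_eq_zero, mul_zero]
    intro l hl
    rw [hL.map_mul_of_ne hlam (fun h => hpar k hk l hl (by rw [h])), mul_zero]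
  · refine Finset.sum_eq_zero fun k hk => ?_
    rw [mul_comm (derivative (U k)), map_sum_C_mul_mul, Finset.sum_eq_zero, mul_zero]
    intro l hl
    rw [hL.map_derivative_mul_derivative_of_parity_ne hlam l k (hpar k hk l hl).symm, mul_zero]

theorem range_eq_sameParity_union (n : ℕ) :
    Finset.range (n + 2) = sameParity (n + 1) ∪ sameParity n := by
  ext k
  simp only [Finset.mem_range, Finset.mem_union, mem_sameParity]
  omega

theorem disjoint_sameParity (n : ℕ) : Disjoint (sameParity (n + 1)) (sameParity n) := by
  rw [Finset.disjoint_left]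
  intro k hk hl
  rw [mem_sameParity] at hk hl
  omega

theorem IsGegenbauerFunctional.upper_bound (hlam : -(1 / 2 : ℝ) < lam)
    (hL : IsGegenbauerFunctional lam L) (h1 : 0 < L 1) (n : ℕ) (p : ℝ[X])
    (hp : p.natDegree ≤ n + 1) :
    L (derivative p * derivative p) ≤ (((n + 1 : ℕ) : ℝ) + 5 / 4 * lam + 9 / 8) ^ 4 /
        (2 * (2 * lam + 1) * Real.sqrt (2 * lam + 5)) * L (p * p) := by
  have hs : 0 < 2 * lam + 1 := by linarith
  have hs5 : 0 < 2 * lam + 5 := by linarith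
  have hn : (0 : ℝ) ≤ n := Nat.cast_nonneg n
  set b := (((n + 1 : ℕ) : ℝ) + 5 / 4 * lam + 9 / 8) ^ 4 /
        (2 * (2 * lam + 1) * Real.sqrt (2 * lam + 5)) with hb
  have hb0 : 0 ≤ b := by positivity
  have hb2 : b ^ 2 = (((n + 1 : ℕ) : ℝ) + 5 / 4 * lam + 9 / 8) ^ 8 /
      (4 * ((2 * lam + 1) ^ 2 * (2 * lam + 5))) := by
    rw [hb, div_pow, mul_pow, Real.sq_sqrt hs5.le]
    ring
  have hpos4 : 0 < 4 * ((2 * lam + 1) ^ 2 * (2 * lam + 5)) := by positivity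
  have hg1 : gramSq lam L (n + 1) ≤ b ^ 2 := by
    rw [hb2, le_div_iff₀' hpos4]
    exact hL.gramSq_le hlam h1 (n + 1)
  have hg0 : gramSq lam L n ≤ b ^ 2 := by
    rw [hb2, le_div_iff₀' hpos4]
    -- The block of the other parity has top index n, and its bound is smaller: the base n + 5λ/4 +
    -- 9/8 is positive and increases with n.
    refine (hL.gramSq_le hlam h1 n).trans (pow_le_pow_left₀ (by linarith) ?_ 8)
    push_cast
    linarith
  obtain ⟨x, hx⟩ := exists_gegenbauerPoly_expansion hlam (n + 1) p hp
  rw [range_eq_sameParity_union, Finset.sum_union (disjoint_sameParity n)] at hx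
  have e1 := hL.derivative_norm_sq_le hlam h1 (sameParity (n + 1)) x b hb0 hg1
  have e0 := hL.derivative_norm_sq_le hlam h1 (sameParity n) x b hb0 hg0
  obtain ⟨o1, o2⟩ := hL.map_blocks hlam n x
  set p1 := ∑ k ∈ sameParity (n + 1), C (x k) * U k
  set p0 := ∑ k ∈ sameParity n, C (x k) * U k
  have hsq : ∀ q r : ℝ[X], L ((q + r) * (q + r)) = L (q * q) + 2 * L (q * r) + L (r * r) := by
    intro q r
    rw [show (q + r) * (q + r) = q * q + (q * r + q * r) + r * r by ring, map_add, map_add, map_add]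
    ring
  rw [hx, derivative_add, hsq, hsq, o1, o2]
  linarith

end Estimates

/-! ### The Markov constant as a supremum -/

theorem gegenbauerNorm_eq {lam : ℝ} (hlam : -(1 / 2 : ℝ) < lam) (p : Polynomial ℝ) :
    gegenbauerNorm lam p = Real.sqrt (gegenbauerFunctional hlam (p * p)) := by
  simp [gegenbauerNorm, gegenbauerFunctional, sq]

theorem theorem1p1 (n : ℕ) (hn : 3 ≤ n) (lam : ℝ) (hlam : -(1 / 2 : ℝ) < lam) :
    IsLeast {c : ℝ | ∀ p : Polynomial ℝ, p.natDegree ≤ n →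
        gegenbauerNorm lam (Polynomial.derivative p) ≤ c * gegenbauerNorm lam p}
      (markovConstant n lam) ∧
    ((n : ℝ) + 1) * ((n : ℝ) + lam + 1 / 2) ^ 2 * ((n : ℝ) + 2 * lam) /
        ((2 * lam + 1) * (2 * lam + 5)) ≤ markovConstant n lam ^ 2 ∧
    markovConstant n lam ^ 2 ≤
      ((n : ℝ) + 5 / 4 * lam + 9 / 8) ^ 4 /
        (2 * (2 * lam + 1) * Real.sqrt (2 * lam + 5)) := by
  have hL : IsGegenbauerFunctional lam (gegenbauerFunctional hlam) :=
    gegenbauerFunctional_integration_by_parts hlam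
  have h1 := gegenbauerFunctional_one_pos hlam
  have hnorm := gegenbauerNorm_eq hlam
  set L := gegenbauerFunctional hlam
  have hs : 0 < 2 * lam + 1 := by linarith
  set b := ((n : ℝ) + 5 / 4 * lam + 9 / 8) ^ 4 /
        (2 * (2 * lam + 1) * Real.sqrt (2 * lam + 5)) with hb
  have hb0 : 0 ≤ b := by positivity
  have hnormpos : ∀ p : Polynomial ℝ, p ≠ 0 → 0 < gegenbauerNorm lam p := fun p hp => by
    rw [hnorm]
    exact Real.sqrt_pos.mpr (hL.map_sq_pos hlam h1 hp)
  have hupper : ∀ p : Polynomial ℝ, p.natDegree ≤ n →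
      gegenbauerNorm lam (Polynomial.derivative p) ≤ Real.sqrt b * gegenbauerNorm lam p := by
    intro p hp
    obtain ⟨m, rfl⟩ : ∃ m, n = m + 1 := ⟨n - 1, by omega⟩
    rw [hnorm, hnorm, ← Real.sqrt_mul hb0]
    exact Real.sqrt_le_sqrt (hL.upper_bound hlam h1 m p hp)
  set S := {r : ℝ | ∃ p : Polynomial ℝ, p ≠ 0 ∧ p.natDegree ≤ n ∧
    r = gegenbauerNorm lam (Polynomial.derivative p) / gegenbauerNorm lam p} with hS
  have hM : markovConstant n lam = sSup S := rfl
  have hle : ∀ c : ℝ, (∀ p : Polynomial ℝ, p.natDegree ≤ n →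
      gegenbauerNorm lam (Polynomial.derivative p) ≤ c * gegenbauerNorm lam p) →
      c ∈ upperBounds S := by
    rintro c hc _ ⟨p, hp, hdeg, rfl⟩
    exact (div_le_iff₀ (hnormpos p hp)).mpr (hc p hdeg)
  have hbdd : BddAbove S := ⟨_, hle _ hupper⟩
  have hne : S.Nonempty := ⟨_, 1, one_ne_zero, by simp, rfl⟩
  have hM0 : 0 ≤ markovConstant n lam := by
    refine Real.sSup_nonneg ?_
    rintro _ ⟨p, -, -, rfl⟩
    exact div_nonneg (Real.sqrt_nonneg _) (Real.sqrt_nonneg _)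
  have hmem : ∀ p : Polynomial ℝ, p.natDegree ≤ n →
      gegenbauerNorm lam (Polynomial.derivative p) ≤
        markovConstant n lam * gegenbauerNorm lam p := by
    intro p hp
    rcases eq_or_ne p 0 with rfl | hp0
    · simp [gegenbauerNorm]
    · exact (div_le_iff₀ (hnormpos p hp0)).mp (le_csSup hbdd ⟨p, hp0, hp, rfl⟩)
  refine ⟨⟨hmem, fun c hc => csSup_le hne (hle c hc)⟩, ?_, ?_⟩
  · refine hL.lower_bound hlam h1 (by omega) _ fun p hp => ?_
    have h := hmem p hp
    -- Putting the constant under the root turns the norm inequality into the quadratic one required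
    -- by `lower_bound`.
    rw [hnorm, hnorm, ← Real.sqrt_sq hM0, ← Real.sqrt_mul (sq_nonneg _)] at h
    have hnn : 0 ≤ markovConstant n lam ^ 2 * L (p * p) := by
      rcases eq_or_ne p 0 with rfl | hp0
      · simp
      · exact mul_nonneg (sq_nonneg _) (hL.map_sq_pos hlam h1 hp0).le
    exact (Real.sqrt_le_sqrt_iff hnn).mp h
  · have h : markovConstant n lam ≤ Real.sqrt b := csSup_le hne (hle _ hupper)
    exact (Real.le_sqrt hM0 hb0).mp h
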